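/- Let $m\ge 1$, let $A:\mathbb R^n\to\mathbb R^m$ be an injective linear map, $c\in\mathbb R^n$, and let $D\subset\mathbb R^m$ be a closed convex set with nonempty interior, whose interior is the domain of a $\vartheta$-self-concordant barrier $\Phi$ (that is: $\Phi$ is $C^3$ and convex on $\operatorname{int}D$, tends to $+\infty$ at every boundary point of $D$, and $|D^3\Phi(z)[h,h,h]|\le 2(D^2\Phi(z)[h,h])^{3/2}$ and $(D\Phi(z)[h])^2\le\vartheta\,D^2\Phi(z)[h,h]$ for all $z\in\operatorname{int}D$, $h\in\mathbb R^m$, with $\vartheta\ge 0$). Let $\operatorname{rec}(D)$ be the recession cone of $D$, $D_*=\{y:\langle y,h\rangle\le 0\ \ \forall h\in\operatorname{rec}(D)\}$, $\delta_*(y|D)=\sup_{z\in D}\langle y,z\rangle\in[-\infty,+\infty]$, and let $\Phi_*(y)=\sup_{z\in\operatorname{int}D}\{\langle y,z\rangle-\Phi(z)\}$ be the Legendre–Fenchel conjugate of $\Phi$, considered on $\operatorname{int}D_*$. Put $$\mathcal F_p=\{x:Ax\in D\},\qquad \mathcal F_d=\{y\in D_*:A^\top y=-c\}.$$ Fix $\xi>1$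 and $z^0\in\operatorname{int}D$, and let $y^0=\Phi'(z^0)$ and $y_{\tau,0}=-\langle y^0,z^0\rangle-\xi\vartheta$. Let $$Q_{DD}=\{(x,\tau,y):\ Ax+\tfrac1\tau z^0\in\operatorname{int}D,\ \tau>0,\ A^\top y-A^\top y^0=-(\tau-1)c,\ y\in\operatorname{int}D_*\},$$ $$\mu(x,\tau,y)=\frac{\tau}{\xi\vartheta}\Big[-y_{\tau,0}-\tau\langle c,x\rangle-\big\langle y,Ax+\tfrac1\tau z^0\big\rangle\Big].$$ A point $(x,\tau,y)\in Q_{DD}$ is called $\kappa$-close to the central path if $\mu:=\mu(x,\tau,y)>0$ and $$\Big\|Ax+\tfrac1\tau z^0-\Phi_*'\big(\tfrac\tau\mu y\big)\Big\|_{[\Phi_*''(\frac\tau\mu y)]^{-1}}\le\kappa,$$ where $\|v\|_{B^{-1}}=\langle v,B^{-1}v\rangle^{1/2}$. Suppose that $\bar x\in\mathcal F_p$ and $\bar y\in\mathcal F_d$ have duality gap $\langle c,\bar x\rangle+\delta_*(\bar y|D)=\Lambda\in\mathbb R$. Then every point $(x,\tau,y)\in Q_{DD}$ that is $\kappa$-close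 to the central path satisfies, with $\mu=\mu(x,\tau,y)$, $$\big((\xi-1)\vartheta-\kappa\sqrt\vartheta\big)\frac{\mu}{\tau}\ \le\ \xi\vartheta+\langle y^0-\bar y,\,z^0-A\bar x\rangle+\tau\Lambda .$$ If moreover $\Lambda=0$ and $\kappa<\xi-1$, then for every such point the numbers $(\xi-1)\vartheta-\kappa\sqrt\vartheta$ and $\xi\vartheta+\langle y^0-\bar y,z^0-A\bar x\rangle$ are positive and $$\mu\ \le\ \left[\frac{\xi\vartheta+\langle y^0-\bar y,\,z^0-A\bar x\rangle}{(\xi-1)\vartheta-\kappa\sqrt\vartheta}\right]\tau ,$$ so that $\tau$ grows at least linearly in $\mu$. -/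

import Mathlib

open Set Filter Topology
open scoped RealInnerProductSpace

noncomputable section

/-- `Φ` is a `ϑ`-self-concordant barrier with (open, convex) domain `U`: it is `C³` and convex
on `U`, satisfies `|D³Φ(z)[h,h,h]| ≤ 2 (D²Φ(z)[h,h])^{3/2}`, tends to `+∞` at every boundary
point of `U`, and satisfies `(DΦ(z)[h])² ≤ ϑ D²Φ(z)[h,h]`. Only the values of `Φ` on `U`
matter. -/
structure IsSelfConcordantBarrier {F : Type*} [NormedAddCommGroup F] [InnerProductSpace ℝ F]
    (Φ : F → ℝ) (U : Set F) (ϑ : ℝ) : Prop where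
  isOpen : IsOpen U
  convexOn : ConvexOn ℝ U Φ
  contDiffOn : ContDiffOn ℝ 3 Φ U
  selfConcordant : ∀ z ∈ U, ∀ h : F,
    |iteratedFDeriv ℝ 3 Φ z (fun _ => h)| ≤
      2 * (iteratedFDeriv ℝ 2 Φ z (fun _ => h)) ^ (3 / 2 : ℝ)
  tendsto_frontier : ∀ z ∈ frontier U, Tendsto Φ (𝓝[U] z) atTop
  parameter_nonneg : 0 ≤ ϑ
  gradient_bound : ∀ z ∈ U, ∀ h : F,
    (fderiv ℝ Φ z h) ^ 2 ≤ ϑ * iteratedFDeriv ℝ 2 Φ z (fun _ => h)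

/-- The recession cone `rec(D)`. -/
def recCone {F : Type*} [NormedAddCommGroup F] [InnerProductSpace ℝ F] (D : Set F) : Set F :=
  {h | ∀ z ∈ D, ∀ t : ℝ, 0 ≤ t → z + t • h ∈ D}

/-- The cone `D_* = {y : ⟨y, h⟩ ≤ 0 for all h ∈ rec(D)}`. -/
def dualCone {F : Type*} [NormedAddCommGroup F] [InnerProductSpace ℝ F] (D : Set F) : Set F :=
  {y | ∀ h ∈ recCone D, ⟪y, h⟫ ≤ 0}

/-- The support function `δ_*(y|D) = sup {⟨y, z⟩ : z ∈ D}`, with values in `[-∞, +∞]`. -/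
def supportFun {F : Type*} [NormedAddCommGroup F] [InnerProductSpace ℝ F]
    (D : Set F) (y : F) : EReal :=
  ⨆ z ∈ D, ((⟪y, z⟫ : ℝ) : EReal)

/-- The Legendre-Fenchel conjugate `Φ_*(y) = sup {⟨y, z⟩ - Φ(z) : z ∈ int D}` of a barrier `Φ`
with domain `int D`. It is only used on `int D_*`, where the supremum is finite. -/
def conjugate {F : Type*} [NormedAddCommGroup F] [InnerProductSpace ℝ F]
    (Φ : F → ℝ) (D : Set F) (y : F) : ℝ :=
  ⨆ z : interior D, (⟪y, (z : F)⟫ - Φ z)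

/-- The gradient `Φ_*'`. -/
def conjugateGradient {F : Type*} [NormedAddCommGroup F] [InnerProductSpace ℝ F]
    [CompleteSpace F] (Φ : F → ℝ) (D : Set F) : F → F :=
  gradient (conjugate Φ D)

/-- The Hessian `Φ_*''(w)`, as a linear operator. -/
def conjugateHessian {F : Type*} [NormedAddCommGroup F] [InnerProductSpace ℝ F]
    [CompleteSpace F] (Φ : F → ℝ) (D : Set F) (w : F) : F →L[ℝ] F :=
  fderiv ℝ (conjugateGradient Φ D) w

/-- The local norm `‖v‖_{B⁻¹} = ⟨v, B⁻¹ v⟩^{1/2}` for a positive definite operator `B`. -/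
def invNorm {F : Type*} [NormedAddCommGroup F] [InnerProductSpace ℝ F]
    (B : F →L[ℝ] F) (v : F) : ℝ :=
  √ ⟪v, B.inverse v⟫

section Problem

variable {E F : Type*} [NormedAddCommGroup E] [InnerProductSpace ℝ E] [CompleteSpace E]
  [NormedAddCommGroup F] [InnerProductSpace ℝ F] [CompleteSpace F]

/-- The primal feasible region `{x : A x ∈ D}`. -/
def primalFeasible (A : E →L[ℝ] F) (D : Set F) : Set E :=
  {x | A x ∈ D}

/-- The dual feasible region `{y ∈ D_* : Aᵀ y = -c}`. -/
def dualFeasible (A : E →L[ℝ] F) (c : E) (D : Set F) : Set F :=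
  {y | y ∈ dualCone D ∧ A.adjoint y = -c}

/-- The duality gap `⟨c, x⟩ + δ_*(y|D)` of a pair `(x, y)`. -/
def dualityGap (c : E) (D : Set F) (x : E) (y : F) : EReal :=
  ((⟪c, x⟫ : ℝ) : EReal) + supportFun D y

/-- The initial dual point `y⁰ = Φ'(z⁰)`. -/
def initialDual (Φ : F → ℝ) (z0 : F) : F :=
  gradient Φ z0

/-- The number `y_{τ,0} = -⟨y⁰, z⁰⟩ - ξ ϑ`. -/
def initialYTau (Φ : F → ℝ) (ϑ ξ : ℝ) (z0 : F) : ℝ :=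
  -⟪initialDual Φ z0, z0⟫ - ξ * ϑ

/-- Membership of `(x, τ, y)` in `Q_DD`. -/
def InQDD (A : E →L[ℝ] F) (c : E) (D : Set F) (Φ : F → ℝ) (z0 : F)
    (x : E) (τ : ℝ) (y : F) : Prop :=
  A x + (1 / τ) • z0 ∈ interior D ∧ 0 < τ ∧
    A.adjoint y - A.adjoint (initialDual Φ z0) = -((τ - 1) • c) ∧
    y ∈ interior (dualCone D)

/-- `μ(x, τ, y) = (τ / (ξ ϑ)) [-y_{τ,0} - τ ⟨c, x⟩ - ⟨y, A x + z⁰ / τ⟩]`. -/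
def muValue (A : E →L[ℝ] F) (c : E) (Φ : F → ℝ) (ϑ ξ : ℝ) (z0 : F)
    (x : E) (τ : ℝ) (y : F) : ℝ :=
  τ / (ξ * ϑ) *
    (-initialYTau Φ ϑ ξ z0 - τ * ⟪c, x⟫ - ⟪y, A x + (1 / τ) • z0⟫)

/-- The point `(x, τ, y)` of `Q_DD` is `κ`-close to the central path: with `μ = μ(x, τ, y)`,
the path parameter `μ` is positive (so that `(τ/μ) y` lies in the domain `int D_*` of `Φ_*`) and
`‖A x + z⁰ / τ - Φ_*'((τ/μ) y)‖_{[Φ_*''((τ/μ) y)]⁻¹} ≤ κ`. -/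
def IsCloseToCentralPath (A : E →L[ℝ] F) (c : E) (D : Set F) (Φ : F → ℝ) (ϑ ξ : ℝ) (z0 : F)
    (κ : ℝ) (x : E) (τ : ℝ) (y : F) : Prop :=
  InQDD A c D Φ z0 x τ y ∧ 0 < muValue A c Φ ϑ ξ z0 x τ y ∧
    invNorm (conjugateHessian Φ D ((τ / muValue A c Φ ϑ ξ z0 x τ y) • y))
      (A x + (1 / τ) • z0 -
        conjugateGradient Φ D ((τ / muValue A c Φ ϑ ξ z0 x τ y) • y)) ≤ κ

end Problem

end

/-!
Write `r = τ / μ`, `w = r • y` and `u = A x + z⁰ / τ`. The definition of `μ` reads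
`ξ ϑ / r = ⟪y⁰, z⁰⟫ + ξ ϑ - τ ⟪c, x⟫ - ⟪y, u⟫`. If `p = Φ_*'(w)`, so that `w = Φ'(p)`, then
closeness to the central path says that `u - p` has norm at most `κ` in the metric
`Φ_*''(w)⁻¹ = Φ''(p)`. The barrier inequality gives `⟪w, p - u⟫ ≤ κ √ϑ`, and semiboundedness gives
`⟪w, A x̄ - p⟫ ≤ ϑ`, because `A x̄ ∈ D`. Hence `⟪y, A x̄⟫ ≤ ⟪y, u⟫ + (ϑ + κ √ϑ) / r`. Together with
the linear relation for `Aᵀ y`, with `Aᵀ ȳ = -c` and with `⟪ȳ, u⟫ ≤ δ_*(ȳ|D)`, this is the first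
claim. The positivity claim needs in addition `1 ≤ ϑ`, so that `√ϑ ≤ ϑ`.

What has to be built is the theory of the barrier and its conjugate behind these steps:

* semiboundedness, `IsSelfConcordantBarrier.fderiv_sub_le_param`, and the lower bound `1 ≤ ϑ`,
  `IsSelfConcordantBarrier.one_le_param`, both by differential inequalities along lines;
* nondegeneracy of `Φ''`, `IsSelfConcordantBarrier.hessian_pos`: a degenerate direction would span
  a line in `D`, and then `D_*` would have empty interior;
* surjectivity of `Φ'` onto the interior of `D_*`, `IsSelfConcordantBarrier.exists_gradient_eq`:
  `Φ - ⟪w, ·⟫` has compact sublevel sets, since `Φ` decreases at most sublinearly at infinity while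
  `⟪w, ·⟫` decreases linearly on `D`;
* the formulas `Φ_*'(Φ'(p)) = p` and `Φ_*''(Φ'(p)) = Φ''(p)⁻¹`, by the inverse function theorem
  (`conjugateGradient_gradient_and_inverse_conjugateHessian`).
-/

/-! ### Convex sets: recession directions and rays -/

section RecessionCone

variable {F : Type*} [NormedAddCommGroup F] [InnerProductSpace ℝ F]

/-- A limit of rescaled points `l k • z k` of a closed convex set, with scaling factors `l k`
tending to zero, is a recession direction. -/
lemma mem_recCone_of_tendsto_smul {D : Set F} (hD : IsClosed D) (hconv : Convex ℝ D)
    {z : ℕ → F} (hz : ∀ k, z k ∈ D) {l : ℕ → ℝ} (hl0 : ∀ k, 0 ≤ l k)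
    (hl : Tendsto l atTop (𝓝 0)) {h : F} (hlim : Tendsto (fun k => l k • z k) atTop (𝓝 h)) :
    h ∈ recCone D := by
  intro q hq t ht
  -- `q + t • h` is the limit of the convex combinations `(1 - t * l k) • q + (t * l k) • z k`.
  have h1 : Tendsto (fun k => (1 - t * l k) • q + t • (l k • z k)) atTop
      (𝓝 ((1 - t * 0) • q + t • h)) :=
    ((tendsto_const_nhds.sub (hl.const_mul t)).smul_const q).add (hlim.const_smul t)
  rw [mul_zero, sub_zero, one_smul] at h1
  refine hD.mem_of_tendsto h1 ?_
  have h2 : ∀ᶠ k in atTop, t * l k < 1 := by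
    have := hl.const_mul t
    rw [mul_zero] at this
    exact this.eventually_lt_const one_pos
  filter_upwards [h2] with k hk
  rw [smul_smul]
  exact hconv hq (hz k) (by linarith) (mul_nonneg ht (hl0 k)) (by ring)

lemma mem_recCone_of_ray_subset {D : Set F} (hD : IsClosed D) (hconv : Convex ℝ D)
    {p h : F} (hp : ∀ t : ℝ, 0 ≤ t → p + t • h ∈ D) : h ∈ recCone D := by
  refine mem_recCone_of_tendsto_smul hD hconv (z := fun k : ℕ => p + ((k : ℝ) + 1) • h)
    (l := fun k : ℕ => 1 / ((k : ℝ) + 1)) (fun k => hp _ (by positivity))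
    (fun k => by positivity) tendsto_one_div_add_atTop_nhds_zero_nat ?_
  have h1 : Tendsto (fun k : ℕ => (1 / ((k : ℝ) + 1)) • p + h) atTop (𝓝 ((0 : ℝ) • p + h)) :=
    (tendsto_one_div_add_atTop_nhds_zero_nat.smul_const p).add_const h
  rw [zero_smul, zero_add] at h1
  refine h1.congr fun k => ?_
  have : (k : ℝ) + 1 ≠ 0 := by positivity
  rw [smul_add, smul_smul, one_div_mul_cancel this, one_smul]

/-- An interior point of `D_*` is uniformly negative on the recession directions. -/
lemma exists_inner_le_of_mem_interior_dualCone {D : Set F} {y : F}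
    (hy : y ∈ interior (dualCone D)) :
    ∃ ε > 0, ∀ h ∈ recCone D, ⟪y, h⟫ ≤ -ε * ‖h‖ := by
  rw [mem_interior_iff_mem_nhds, Metric.mem_nhds_iff] at hy
  obtain ⟨r, hr, hball⟩ := hy
  refine ⟨r / 2, by positivity, fun h hh => ?_⟩
  rcases eq_or_ne h 0 with rfl | hne
  · simp
  have hn : 0 < ‖h‖ := norm_pos_iff.2 hne
  have hmem : y + (r / 2 / ‖h‖) • h ∈ Metric.ball y r := by
    rw [Metric.mem_ball, dist_eq_norm, add_sub_cancel_left, norm_smul, Real.norm_eq_abs,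
      abs_of_pos (by positivity), div_mul_cancel₀ _ hn.ne']
    linarith
  have := hball hmem h hh
  rw [inner_add_left, inner_smul_left, real_inner_self_eq_norm_sq] at this
  have h3 : r / 2 / ‖h‖ * ‖h‖ ^ 2 = r / 2 * ‖h‖ := by field_simp
  simp only [conj_trivial] at this
  linarith

/-- If `y` is uniformly negative on the recession directions of `D`, then on `D` the functional
`⟪y, ·⟫` decreases at least linearly at infinity. -/
lemma exists_inner_le_of_forall_recCone [FiniteDimensional ℝ F] {D : Set F} (hD : IsClosed D)
    (hconv : Convex ℝ D) {y : F} {ε : ℝ} (hε : 0 < ε)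
    (hy : ∀ h ∈ recCone D, ⟪y, h⟫ ≤ -ε * ‖h‖) :
    ∃ R : ℝ, ∀ z ∈ D, R ≤ ‖z‖ → ⟪y, z⟫ ≤ -(ε / 2) * ‖z‖ := by
  -- Otherwise a limit of directions of escaping points is a recession direction violating `hy`.
  by_contra! hcon
  choose z hzD hzn hz using fun k : ℕ => hcon ((k : ℝ) + 1)
  have hpos : ∀ k, 0 < ‖z k‖ := fun k => lt_of_lt_of_le (by positivity) (hzn k)
  have hu : ∀ k, ‖z k‖⁻¹ • z k ∈ Metric.sphere (0 : F) 1 := fun k => by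
    rw [mem_sphere_zero_iff_norm, norm_smul, norm_inv, norm_norm, inv_mul_cancel₀ (hpos k).ne']
  obtain ⟨h, hh, s, hs, hlim⟩ := (isCompact_sphere (0 : F) 1).tendsto_subseq hu
  rw [mem_sphere_zero_iff_norm] at hh
  have hinv : Tendsto (fun k => ‖z k‖⁻¹) atTop (𝓝 0) := by
    refine tendsto_inv_atTop_zero.comp (tendsto_atTop_mono hzn ?_)
    exact tendsto_atTop_add_const_right _ _ tendsto_natCast_atTop_atTop
  have hrec : h ∈ recCone D := mem_recCone_of_tendsto_smul hD hconv (fun k => hzD (s k))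
    (fun k => inv_nonneg.2 (norm_nonneg (z (s k)))) (hinv.comp hs.tendsto_atTop) hlim
  have h1 := hy h hrec
  have h2 : -(ε / 2) ≤ ⟪y, h⟫ := by
    refine ge_of_tendsto (tendsto_const_nhds.inner hlim) (Eventually.of_forall fun k => ?_)
    have h3 := hz (s k)
    have h4 := hpos (s k)
    simp only [Function.comp, inner_smul_right]
    rw [inv_mul_eq_div, le_div_iff₀ h4]
    exact h3.le
  rw [hh] at h1
  linarith

/-- A ray that starts in an open set `U` and leaves it has a first exit point, which lies on the
frontier of `U`. -/
lemma exists_exit_of_ray {U : Set F} (hU : IsOpen U) {p h : F} (hp : p ∈ U)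
    (hout : ∃ t : ℝ, 0 ≤ t ∧ p + t • h ∉ U) :
    ∃ T > 0, (∀ t ∈ Ico (0 : ℝ) T, p + t • h ∈ U) ∧ p + T • h ∈ frontier U := by
  have hcont : Continuous fun t : ℝ => p + t • h := by fun_prop
  let S : Set ℝ := Ici 0 ∩ (fun t : ℝ => p + t • h) ⁻¹' Uᶜ
  have hS : IsClosed S := isClosed_Ici.inter (hU.isClosed_compl.preimage hcont)
  have hne : S.Nonempty := let ⟨t, h0, h1⟩ := hout; ⟨t, h0, h1⟩
  have hbdd : BddBelow S := ⟨0, fun t ht => ht.1⟩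
  have hmem : sInf S ∈ S := hS.csInf_mem hne hbdd
  have hlt : ∀ t ∈ Ico (0 : ℝ) (sInf S), p + t • h ∈ U := fun t ht => by
    by_contra hn
    exact absurd (csInf_le hbdd ⟨ht.1, hn⟩) (not_le.2 ht.2)
  have hpos : 0 < sInf S := by
    refine lt_of_le_of_ne hmem.1 fun h0 => hmem.2 ?_
    simpa [← h0] using hp
  refine ⟨sInf S, hpos, hlt, ?_⟩
  rw [hU.frontier_eq]
  refine ⟨?_, hmem.2⟩
  refine mem_closure_of_tendsto (b := 𝓝[<] (sInf S))
    ((hcont.tendsto (sInf S)).mono_left nhdsWithin_le_nhds) ?_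
  filter_upwards [Ico_mem_nhdsLT hpos] with t ht using hlt t ht

end RecessionCone

/-! ### Self-concordant barriers along lines -/

namespace IsSelfConcordantBarrier

variable {F : Type*} [NormedAddCommGroup F] [InnerProductSpace ℝ F] {Φ : F → ℝ} {U : Set F}
  {ϑ : ℝ}

lemma contDiffAt (hΦ : IsSelfConcordantBarrier Φ U ϑ) {p : F} (hp : p ∈ U) :
    ContDiffAt ℝ 3 Φ p :=
  hΦ.contDiffOn.contDiffAt (hΦ.isOpen.mem_nhds hp)

lemma hasFDerivAt (hΦ : IsSelfConcordantBarrier Φ U ϑ) {p : F} (hp : p ∈ U) :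
    HasFDerivAt Φ (fderiv ℝ Φ p) p :=
  ((hΦ.contDiffAt hp).differentiableAt (by norm_num)).hasFDerivAt

lemma hasFDerivAt_fderiv (hΦ : IsSelfConcordantBarrier Φ U ϑ) {p : F} (hp : p ∈ U) :
    HasFDerivAt (fderiv ℝ Φ) (fderiv ℝ (fderiv ℝ Φ) p) p :=
  (((hΦ.contDiffAt hp).fderiv_right (m := 2) (by norm_num)).differentiableAt
    (by norm_num)).hasFDerivAt

lemma hasDerivAt_line {p h : F} (t : ℝ) : HasDerivAt (fun s : ℝ => p + s • h) h t := by
  simpa using ((hasDerivAt_id t).smul_const h).const_add p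

lemma hasDerivAt_comp_line (hΦ : IsSelfConcordantBarrier Φ U ϑ) {p h : F} {t : ℝ}
    (ht : p + t • h ∈ U) :
    HasDerivAt (fun s : ℝ => Φ (p + s • h)) (fderiv ℝ Φ (p + t • h) h) t :=
  (hΦ.hasFDerivAt ht).comp_hasDerivAt t (hasDerivAt_line t)

lemma hasDerivAt_fderiv_line (hΦ : IsSelfConcordantBarrier Φ U ϑ) {p h : F} {t : ℝ}
    (ht : p + t • h ∈ U) :
    HasDerivAt (fun s : ℝ => fderiv ℝ Φ (p + s • h) h)
      (iteratedFDeriv ℝ 2 Φ (p + t • h) fun _ => h) t := by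
  rw [iteratedFDeriv_two_apply]
  exact (ContinuousLinearMap.apply ℝ ℝ h).hasFDerivAt.comp_hasDerivAt t
    ((hΦ.hasFDerivAt_fderiv ht).comp_hasDerivAt t (hasDerivAt_line t))

lemma hasDerivAt_iteratedFDeriv_line (hΦ : IsSelfConcordantBarrier Φ U ϑ) {p h : F} {t : ℝ}
    (ht : p + t • h ∈ U) :
    HasDerivAt (fun s : ℝ => iteratedFDeriv ℝ 2 Φ (p + s • h) fun _ => h)
      (iteratedFDeriv ℝ 3 Φ (p + t • h) fun _ => h) t := by
  have h1 : DifferentiableAt ℝ (iteratedFDeriv ℝ 2 Φ) (p + t • h) :=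
    (hΦ.contDiffAt ht).differentiableAt_iteratedFDeriv (by norm_num)
  have h2 := h1.hasFDerivAt.comp_hasDerivAt t (hasDerivAt_line t)
  have h3 := (ContinuousMultilinearMap.apply ℝ (fun _ : Fin 2 => F) ℝ
    (fun _ => h)).hasFDerivAt.comp_hasDerivAt t h2
  exact h3

lemma fderiv_sub_le (hΦ : IsSelfConcordantBarrier Φ U ϑ) {p z : F} (hp : p ∈ U) (hz : z ∈ U) :
    fderiv ℝ Φ p (z - p) ≤ Φ z - Φ p := by
  have hc : ConvexOn ℝ (Icc (0 : ℝ) 1) (fun t : ℝ => Φ (p + t • (z - p))) := by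
    refine ⟨convex_Icc 0 1, fun s hs t ht a b ha hb hab => ?_⟩
    have e : p + (a • s + b • t) • (z - p)
        = a • (p + s • (z - p)) + b • (p + t • (z - p)) := by
      have : p = (a + b) • p := by rw [hab, one_smul]
      nth_rewrite 1 [this]
      simp only [smul_eq_mul]
      module
    simp only [e]
    exact hΦ.convexOn.2 (hΦ.convexOn.1.add_smul_sub_mem hp hz hs)
      (hΦ.convexOn.1.add_smul_sub_mem hp hz ht) ha hb hab
  have h0 : HasDerivAt (fun t : ℝ => Φ (p + t • (z - p))) (fderiv ℝ Φ p (z - p)) 0 := by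
    have := hΦ.hasDerivAt_comp_line (p := p) (h := z - p) (t := 0) (by simpa using hp)
    simpa using this
  have := hc.le_slope_of_hasDerivAt (x := 0) (y := 1) (by simp) (by simp) one_pos h0
  simpa [slope_def_field] using this

lemma hessian_nonneg (hΦ : IsSelfConcordantBarrier Φ U ϑ) (hϑ : 0 < ϑ) {p : F} (hp : p ∈ U)
    (h : F) : 0 ≤ iteratedFDeriv ℝ 2 Φ p fun _ => h :=
  nonneg_of_mul_nonneg_right ((sq_nonneg _).trans (hΦ.gradient_bound p hp h)) hϑ

lemma abs_fderiv_le (hΦ : IsSelfConcordantBarrier Φ U ϑ) {p : F} (hp : p ∈ U) (h : F) :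
    |fderiv ℝ Φ p h| ≤ √ϑ * √(iteratedFDeriv ℝ 2 Φ p fun _ => h) := by
  rw [← Real.sqrt_mul hΦ.parameter_nonneg]
  exact Real.abs_le_sqrt (hΦ.gradient_bound p hp h)

/-- The semiboundedness of a barrier: with `g` the derivative of `Φ` along the segment from `p`
to `z`, the barrier inequality `g ^ 2 ≤ ϑ * g'` makes `ϑ / g + t` nonincreasing as long as
`g > 0`, so `ϑ / g` drops by at least `1` over the segment. -/
lemma fderiv_sub_le_param (hΦ : IsSelfConcordantBarrier Φ U ϑ) (hϑ : 0 < ϑ) {p z : F}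
    (hp : p ∈ U) (hz : z ∈ U) : fderiv ℝ Φ p (z - p) ≤ ϑ := by
  by_contra! hcon
  set g : ℝ → ℝ := fun t => fderiv ℝ Φ (p + t • (z - p)) (z - p) with hg
  set g' : ℝ → ℝ := fun t => iteratedFDeriv ℝ 2 Φ (p + t • (z - p)) fun _ => z - p with hg'
  have hU : ∀ t ∈ Icc (0 : ℝ) 1, p + t • (z - p) ∈ U := fun t ht =>
    hΦ.convexOn.1.add_smul_sub_mem hp hz ht
  have hd : ∀ t ∈ Icc (0 : ℝ) 1, HasDerivAt g (g' t) t := fun t ht =>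
    hΦ.hasDerivAt_fderiv_line (hU t ht)
  have hg0 : g 0 = fderiv ℝ Φ p (z - p) := by simp [hg]
  have hmono : MonotoneOn g (Icc 0 1) :=
    monotoneOn_of_hasDerivWithinAt_nonneg (convex_Icc 0 1)
      (fun t ht => (hd t ht).continuousAt.continuousWithinAt)
      (fun t ht => (hd t (interior_subset ht)).hasDerivWithinAt)
      (fun t ht => hΦ.hessian_nonneg hϑ (hU t (interior_subset ht)) _)
  have hpos : ∀ t ∈ Icc (0 : ℝ) 1, 0 < g t := fun t ht => by
    have := hmono (by simp) ht ht.1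
    linarith
  have hd2 : ∀ t ∈ Icc (0 : ℝ) 1,
      HasDerivAt (fun t => ϑ * (g t)⁻¹ + t) (ϑ * (-g' t / g t ^ 2) + 1) t := fun t ht =>
    (((hd t ht).inv (hpos t ht).ne').const_mul ϑ).add (hasDerivAt_id t)
  have hanti : AntitoneOn (fun t => ϑ * (g t)⁻¹ + t) (Icc 0 1) := by
    refine antitoneOn_of_hasDerivWithinAt_nonpos (convex_Icc 0 1)
      (fun t ht => (hd2 t ht).continuousAt.continuousWithinAt)
      (fun t ht => (hd2 t (interior_subset ht)).hasDerivWithinAt) (fun t ht => ?_)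
    have ht' := interior_subset ht
    have h1 : g t ^ 2 ≤ ϑ * g' t := hΦ.gradient_bound _ (hU t ht') _
    have h2 : 0 < g t ^ 2 := pow_pos (hpos t ht') 2
    have h3 : 1 ≤ ϑ * g' t / g t ^ 2 := (one_le_div h2).2 h1
    have h4 : ϑ * (-g' t / g t ^ 2) = -(ϑ * g' t / g t ^ 2) := by ring
    linarith
  have h01 := hanti (by simp) (by simp) (zero_le_one' ℝ)
  have h1 : 0 < ϑ * (g 1)⁻¹ := mul_pos hϑ (inv_pos.2 (hpos 1 (by simp)))
  have h0 : ϑ * (g 0)⁻¹ < 1 := by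
    rw [← div_eq_mul_inv, div_lt_one (hpos 0 (by simp)), hg0]
    exact hcon
  simp only at h01
  linarith

lemma fderiv_sub_le_param_of_mem_closure (hΦ : IsSelfConcordantBarrier Φ U ϑ) (hϑ : 0 < ϑ)
    {p z : F} (hp : p ∈ U) (hz : z ∈ closure U) : fderiv ℝ Φ p (z - p) ≤ ϑ := by
  have hcl : IsClosed {z : F | fderiv ℝ Φ p (z - p) ≤ ϑ} :=
    isClosed_le (by fun_prop) continuous_const
  exact closure_minimal (fun z hz => hΦ.fderiv_sub_le_param hϑ hp hz) hcl hz

/-- Along a ray that leaves the domain, a barrier blows up at the first exit time. -/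
lemma exists_exit_time (hΦ : IsSelfConcordantBarrier Φ U ϑ) {p h : F} (hp : p ∈ U)
    (hout : ∃ t : ℝ, 0 ≤ t ∧ p + t • h ∉ U) :
    ∃ T > 0, (∀ t ∈ Ico (0 : ℝ) T, p + t • h ∈ U) ∧
      Tendsto (fun t : ℝ => Φ (p + t • h)) (𝓝[<] T) atTop := by
  obtain ⟨T, hT, hin, hfr⟩ := exists_exit_of_ray hΦ.isOpen hp hout
  refine ⟨T, hT, hin, (hΦ.tendsto_frontier _ hfr).comp ?_⟩
  refine tendsto_nhdsWithin_iff.2 ⟨?_, ?_⟩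
  · exact ((hasDerivAt_line T).continuousAt.tendsto).mono_left nhdsWithin_le_nhds
  · filter_upwards [Ico_mem_nhdsLT hT] with t ht using hin t ht

lemma abs_iteratedFDeriv_three_le (hΦ : IsSelfConcordantBarrier Φ U ϑ) (hϑ : 0 < ϑ) {p : F}
    (hp : p ∈ U) (h : F) :
    |iteratedFDeriv ℝ 3 Φ p fun _ => h| ≤ 2 * ((iteratedFDeriv ℝ 2 Φ p fun _ => h) *
      √(iteratedFDeriv ℝ 2 Φ p fun _ => h)) := by
  refine (hΦ.selfConcordant p hp h).trans_eq ?_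
  have h0 := hΦ.hessian_nonneg hϑ hp h
  rw [show (3 / 2 : ℝ) = 1 + 1 / 2 by norm_num, Real.rpow_add_of_nonneg h0 (by norm_num)
    (by norm_num), Real.rpow_one, ← Real.sqrt_eq_rpow]

/-- If the Hessian at `p` degenerates in the direction `h`, then the whole ray from `p` in this
direction lies in the domain: self-concordance and Grönwall's inequality keep the Hessian
degenerate along the ray, hence `Φ` is constant there and cannot blow up at an exit point. -/
lemma ray_subset_of_hessian_eq_zero (hΦ : IsSelfConcordantBarrier Φ U ϑ) (hϑ : 0 < ϑ) {p h : F}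
    (hp : p ∈ U) (hh : (iteratedFDeriv ℝ 2 Φ p fun _ => h) = 0) (t : ℝ) (ht : 0 ≤ t) :
    p + t • h ∈ U := by
  by_contra hout
  obtain ⟨T, hT, hin, hlim⟩ := hΦ.exists_exit_time hp ⟨t, ht, hout⟩
  set u : ℝ → ℝ := fun t => iteratedFDeriv ℝ 2 Φ (p + t • h) fun _ => h with hu
  have hu0 : ∀ b ∈ Ico (0 : ℝ) T, u b = 0 := fun b hb => by
    have hin' : ∀ t ∈ Icc (0 : ℝ) b, p + t • h ∈ U := fun t ht => hin t ⟨ht.1, ht.2.trans_lt hb.2⟩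
    have hcont : ContinuousOn u (Icc 0 b) := fun t ht =>
      (hΦ.hasDerivAt_iteratedFDeriv_line (hin' t ht)).continuousAt.continuousWithinAt
    obtain ⟨M, hM⟩ := isCompact_Icc.bddAbove_image hcont
    refine eq_zero_of_abs_deriv_le_mul_abs_self_of_eq_zero_right (K := 2 * √M) hcont
      (fun t ht => (hΦ.hasDerivAt_iteratedFDeriv_line
        (hin' t (Ico_subset_Icc_self ht))).hasDerivWithinAt) (by simpa [hu] using hh)
      (fun t ht => ?_) b ⟨hb.1, le_rfl⟩
    have ht' := Ico_subset_Icc_self ht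
    have h0 : 0 ≤ u t := hΦ.hessian_nonneg hϑ (hin' t ht') h
    rw [Real.norm_eq_abs, Real.norm_eq_abs, abs_of_nonneg h0]
    refine (hΦ.abs_iteratedFDeriv_three_le hϑ (hin' t ht') h).trans ?_
    have hs : √(u t) ≤ √M := Real.sqrt_le_sqrt (hM (mem_image_of_mem u ht'))
    have := mul_le_mul_of_nonneg_left hs h0
    linarith
  have hconst : ∀ b ∈ Ico (0 : ℝ) T, Φ (p + b • h) = Φ p := fun b hb => by
    have hin' : ∀ t ∈ Icc (0 : ℝ) b, t ∈ Ico 0 T := fun t ht => ⟨ht.1, ht.2.trans_lt hb.2⟩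
    have := constant_of_has_deriv_right_zero (f := fun t : ℝ => Φ (p + t • h)) (a := 0) (b := b)
      (fun t ht => (hΦ.hasDerivAt_comp_line (hin t (hin' t ht))).continuousAt.continuousWithinAt)
      (fun t ht => ?_) b ⟨hb.1, le_rfl⟩
    · simpa using this
    · have ht' := hin' t (Ico_subset_Icc_self ht)
      have h1 := hΦ.gradient_bound _ (hin t ht') h
      have h2 : fderiv ℝ Φ (p + t • h) h = 0 := by
        have h3 := hu0 t ht'
        simp only [hu] at h3
        rw [h3, mul_zero] at h1
        exact pow_eq_zero_iff two_ne_zero |>.1 (le_antisymm h1 (sq_nonneg _))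
      simpa [h2] using (hΦ.hasDerivAt_comp_line (hin t ht')).hasDerivWithinAt (s := Ici t)
  obtain ⟨s, hs1, hs2⟩ := ((hlim.eventually_gt_atTop (Φ p)).and (Ico_mem_nhdsLT hT)).exists
  exact absurd (hconst s hs2) hs1.ne'

/-- The parameter of a nondegenerate barrier on a proper subset is at least `1`. Let `φ` be the
restriction of `Φ` to a ray that leaves the domain. Where `φ' > 0`, the function `φ' ^ 2 / φ''`
has derivative at least `2 * (1 - √ϑ) * φ'`. If `ϑ < 1`, it would therefore blow up with `φ` at the
exit point, although it is at most `ϑ`. -/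
lemma one_le_param (hΦ : IsSelfConcordantBarrier Φ U ϑ) (hϑ : 0 < ϑ) {p : F} (hp : p ∈ U)
    (hU : U ≠ univ) (hpd : ∀ z ∈ U, ∀ h : F, h ≠ 0 → 0 < iteratedFDeriv ℝ 2 Φ z fun _ => h) :
    1 ≤ ϑ := by
  by_contra! hlt
  obtain ⟨q, hq⟩ := (ne_univ_iff_exists_notMem U).1 hU
  set h := q - p with hh
  have hne : h ≠ 0 := fun h0 => hq (by rwa [sub_eq_zero.1 (hh.symm.trans h0)])
  obtain ⟨T, hT, hin, hlim⟩ := hΦ.exists_exit_time (h := h) hp ⟨1, zero_le_one, by simpa [hh]⟩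
  set f : ℝ → ℝ := fun t => Φ (p + t • h) with hf
  set f1 : ℝ → ℝ := fun t => fderiv ℝ Φ (p + t • h) h with hf1
  set f2 : ℝ → ℝ := fun t => iteratedFDeriv ℝ 2 Φ (p + t • h) fun _ => h with hf2
  set f3 : ℝ → ℝ := fun t => iteratedFDeriv ℝ 3 Φ (p + t • h) fun _ => h with hf3
  have d0 : ∀ t ∈ Ico 0 T, HasDerivAt f (f1 t) t := fun t ht => hΦ.hasDerivAt_comp_line (hin t ht)
  have d1 : ∀ t ∈ Ico 0 T, HasDerivAt f1 (f2 t) t := fun t ht =>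
    hΦ.hasDerivAt_fderiv_line (hin t ht)
  have d2 : ∀ t ∈ Ico 0 T, HasDerivAt f2 (f3 t) t := fun t ht =>
    hΦ.hasDerivAt_iteratedFDeriv_line (hin t ht)
  have p2 : ∀ t ∈ Ico 0 T, 0 < f2 t := fun t ht => hpd _ (hin t ht) h hne
  have hmono : MonotoneOn f1 (Ico 0 T) :=
    monotoneOn_of_hasDerivWithinAt_nonneg (convex_Ico 0 T)
      (fun t ht => (d1 t ht).continuousAt.continuousWithinAt)
      (fun t ht => (d1 t (interior_subset ht)).hasDerivWithinAt)
      (fun t ht => (p2 t (interior_subset ht)).le)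
  obtain ⟨s, hs1, hs2⟩ := ((hlim.eventually_gt_atTop (f 0)).and (Ioo_mem_nhdsLT hT)).exists
  have hsT : ∀ t ∈ Icc 0 s, t ∈ Ico 0 T := fun t ht => ⟨ht.1, ht.2.trans_lt hs2.2⟩
  obtain ⟨a, ha, hslope⟩ := exists_hasDerivAt_eq_slope f f1 hs2.1
    (fun t ht => (d0 t (hsT t ht)).continuousAt.continuousWithinAt)
    (fun t ht => d0 t (hsT t (Ioo_subset_Icc_self ht)))
  have ha1 : 0 < f1 a := by
    rw [hslope]
    exact div_pos (sub_pos.2 hs1) (sub_pos.2 hs2.1)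
  have haT : a ∈ Ico 0 T := hsT a (Ioo_subset_Icc_self ha)
  have hsub : ∀ t ∈ Ico a T, t ∈ Ico 0 T := fun t ht => ⟨haT.1.trans ht.1, ht.2⟩
  have p1 : ∀ t ∈ Ico a T, 0 < f1 t := fun t ht => ha1.trans_le (hmono haT (hsub t ht) ht.1)
  have hr : √ϑ < 1 := by
    rw [Real.sqrt_lt' one_pos]
    simpa using hlt
  have d3 : ∀ t ∈ Ico a T, HasDerivAt (fun t => f1 t ^ 2 / f2 t - 2 * (1 - √ϑ) * f t)
      ((2 * f1 t * f2 t * f2 t - f1 t ^ 2 * f3 t) / f2 t ^ 2 - 2 * (1 - √ϑ) * f1 t) t :=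
    fun t ht => by
      have := (((d1 t (hsub t ht)).pow 2).div (d2 t (hsub t ht)) (p2 t (hsub t ht)).ne').sub
        ((d0 t (hsub t ht)).const_mul (2 * (1 - √ϑ)))
      refine this.congr_deriv ?_
      simp
  have hmono2 : MonotoneOn (fun t => f1 t ^ 2 / f2 t - 2 * (1 - √ϑ) * f t) (Ico a T) := by
    refine monotoneOn_of_hasDerivWithinAt_nonneg (convex_Ico a T)
      (fun t ht => (d3 t ht).continuousAt.continuousWithinAt)
      (fun t ht => (d3 t (interior_subset ht)).hasDerivWithinAt) (fun t ht => ?_)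
    have ht' := interior_subset ht
    have b1 := p1 t ht'
    have b2 := p2 t (hsub t ht')
    have hU' := hin t (hsub t ht')
    have c3 : f3 t ≤ 2 * (f2 t * √(f2 t)) :=
      (le_abs_self _).trans (hΦ.abs_iteratedFDeriv_three_le hϑ hU' h)
    have c1 : f1 t ≤ √ϑ * √(f2 t) := (le_abs_self _).trans (hΦ.abs_fderiv_le hU' h)
    have c2 : f1 t * √(f2 t) ≤ √ϑ * f2 t := by
      calc f1 t * √(f2 t) ≤ √ϑ * √(f2 t) * √(f2 t) :=
            mul_le_mul_of_nonneg_right c1 (Real.sqrt_nonneg _)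
        _ = √ϑ * f2 t := by rw [mul_assoc, Real.mul_self_sqrt b2.le]
    have c4 : f1 t ^ 2 * f3 t ≤ 2 * f1 t * f2 t * (√ϑ * f2 t) := by
      calc f1 t ^ 2 * f3 t ≤ f1 t ^ 2 * (2 * (f2 t * √(f2 t))) :=
            mul_le_mul_of_nonneg_left c3 (sq_nonneg _)
        _ = 2 * f1 t * f2 t * (f1 t * √(f2 t)) := by ring
        _ ≤ _ := mul_le_mul_of_nonneg_left c2 (by positivity)
    rw [sub_nonneg, le_div_iff₀ (by positivity)]
    linarith
  set B := (ϑ - (f1 a ^ 2 / f2 a - 2 * (1 - √ϑ) * f a)) / (2 * (1 - √ϑ)) with hB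
  obtain ⟨t, ht1, ht2⟩ := ((hlim.eventually_gt_atTop B).and (Ico_mem_nhdsLT haT.2)).exists
  have m := hmono2 ⟨le_rfl, haT.2⟩ ht2 ht2.1
  have e1 : f1 t ^ 2 / f2 t ≤ ϑ := by
    rw [div_le_iff₀ (p2 t (hsub t ht2))]
    exact hΦ.gradient_bound _ (hin t (hsub t ht2)) h
  rw [hB, div_lt_iff₀ (by linarith)] at ht1
  simp only at m
  linarith

end IsSelfConcordantBarrier

/-! ### The conjugate barrier -/

namespace IsSelfConcordantBarrier

variable {F : Type*} [NormedAddCommGroup F] [InnerProductSpace ℝ F]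
  {Φ : F → ℝ} {D : Set F} {ϑ : ℝ}

/-- If `D_*` has an interior point, then `D` contains no line, and the Hessian of a barrier for
`D` is positive definite: by `ray_subset_of_hessian_eq_zero`, a degenerate direction would span a
line of recession directions. -/
lemma hessian_pos (hΦ : IsSelfConcordantBarrier Φ (interior D) ϑ) (hϑ : 0 < ϑ) (hD : IsClosed D)
    (hconv : Convex ℝ D) {y : F} (hy : y ∈ interior (dualCone D)) {p : F} (hp : p ∈ interior D)
    {h : F} (hne : h ≠ 0) : 0 < iteratedFDeriv ℝ 2 Φ p fun _ => h := by
  refine lt_of_le_of_ne (hΦ.hessian_nonneg hϑ hp h) fun h0 => ?_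
  have h0' : (iteratedFDeriv ℝ 2 Φ p fun _ => -h) = 0 := by
    rw [iteratedFDeriv_two_apply] at h0 ⊢
    simpa using h0.symm
  have r1 : h ∈ recCone D := mem_recCone_of_ray_subset hD hconv fun t ht =>
    interior_subset (hΦ.ray_subset_of_hessian_eq_zero hϑ hp h0.symm t ht)
  have r2 : -h ∈ recCone D := mem_recCone_of_ray_subset hD hconv fun t ht =>
    interior_subset (hΦ.ray_subset_of_hessian_eq_zero hϑ hp h0' t ht)
  obtain ⟨ε, hε, hle⟩ := exists_inner_le_of_mem_interior_dualCone hy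
  have e1 := hle _ r1
  have e2 := hle _ r2
  rw [norm_neg, inner_neg_right] at e2
  have := mul_pos hε (norm_pos_iff.2 hne)
  linarith

/-- A barrier decreases at most sublinearly at infinity: the slope `ϑ / s` can be made as small as
desired. Semiboundedness at the point of the segment `[z0, z]` at distance `s` from `z0`, tested
against `z0`, bounds the slope of `Φ` towards `z`. -/
lemma sublinear_lower_bound {U : Set F} (hΦ : IsSelfConcordantBarrier Φ U ϑ) (hϑ : 0 < ϑ)
    {z0 z : F} (hz0 : z0 ∈ U) (hz : z ∈ U) {s : ℝ} (hs : 0 < s) (hsz : s ≤ ‖z - z0‖) :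
    Φ z0 - ‖fderiv ℝ Φ z0‖ * s - ϑ / s * ‖z - z0‖ ≤ Φ z := by
  have hn : 0 < ‖z - z0‖ := hs.trans_le hsz
  set l := s / ‖z - z0‖ with hl
  have hl0 : 0 < l := div_pos hs hn
  have hl1 : l ≤ 1 := (div_le_one hn).2 hsz
  set q := z0 + l • (z - z0) with hq
  have hqU : q ∈ U := hΦ.convexOn.1.add_smul_sub_mem hz0 hz ⟨hl0.le, hl1⟩
  have h1 := hΦ.fderiv_sub_le hqU hz
  have h2 := hΦ.fderiv_sub_le hz0 hqU
  have h3 := hΦ.fderiv_sub_le_param hϑ hqU hz0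
  have e1 : z - q = (1 - l) • (z - z0) := by rw [hq]; module
  have e2 : q - z0 = l • (z - z0) := by rw [hq]; module
  have e3 : z0 - q = -(l • (z - z0)) := by rw [hq]; module
  rw [e1, map_smul, smul_eq_mul] at h1
  rw [e3, map_neg, map_smul, smul_eq_mul] at h3
  have h4 : -(‖fderiv ℝ Φ z0‖ * s) ≤ fderiv ℝ Φ z0 (q - z0) := by
    have h5 := (fderiv ℝ Φ z0).le_opNorm (q - z0)
    have h6 : ‖q - z0‖ = s := by
      rw [e2, norm_smul, Real.norm_eq_abs, abs_of_pos hl0, hl, div_mul_cancel₀ _ hn.ne']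
    rw [h6, Real.norm_eq_abs] at h5
    exact (abs_le.1 h5).1
  have h7 : ϑ / s * ‖z - z0‖ = ϑ / l := by
    rw [hl]
    field_simp
  have h8 : -(ϑ / l) ≤ fderiv ℝ Φ q (z - z0) := by
    rw [neg_le, le_div_iff₀ hl0]
    linarith
  have h9 : -(ϑ / l) ≤ (1 - l) * fderiv ℝ Φ q (z - z0) := by
    have h10 := mul_le_mul_of_nonneg_left h8 (sub_nonneg.2 hl1)
    have h11 : 0 < ϑ / l := div_pos hϑ hl0
    nlinarith
  linarith

/-- By convexity, the supremum defining the conjugate at `Φ'(p)` is attained at `p`. -/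
lemma conjugate_gradient [CompleteSpace F] (hΦ : IsSelfConcordantBarrier Φ (interior D) ϑ) {p : F}
    (hp : p ∈ interior D) :
    conjugate Φ D (gradient Φ p) = ⟪gradient Φ p, p⟫ - Φ p := by
  have hle : ∀ z : interior D, ⟪gradient Φ p, (z : F)⟫ - Φ z ≤ ⟪gradient Φ p, p⟫ - Φ p := by
    intro z
    have h1 := hΦ.fderiv_sub_le hp z.2
    rw [← inner_gradient_left, inner_sub_right] at h1
    linarith
  have : Nonempty (interior D) := ⟨⟨p, hp⟩⟩
  exact le_antisymm (ciSup_le hle)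
    (le_ciSup (f := fun z : interior D => ⟪gradient Φ p, (z : F)⟫ - Φ z)
      ⟨_, forall_mem_range.2 hle⟩ ⟨p, hp⟩)

variable [FiniteDimensional ℝ F]

/-- On `D` the functional `⟪w, ·⟫` decreases linearly at infinity and `Φ` decreases at most
sublinearly, so the sublevel sets of `Φ - ⟪w, ·⟫` are bounded. They are closed because `Φ` blows up
at the boundary. -/
lemma isCompact_sublevel (hΦ : IsSelfConcordantBarrier Φ (interior D) ϑ) (hϑ : 0 < ϑ)
    (hD : IsClosed D) (hconv : Convex ℝ D) {w : F} {ε : ℝ} (hε : 0 < ε)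
    (hw : ∀ h ∈ recCone D, ⟪w, h⟫ ≤ -ε * ‖h‖) {z0 : F} (hz0 : z0 ∈ interior D) (M : ℝ) :
    IsCompact {z | z ∈ interior D ∧ Φ z - ⟪w, z⟫ ≤ M} := by
  refine Metric.isCompact_of_isClosed_isBounded ?_ ?_
  · refine isClosed_of_closure_subset fun z hz => ?_
    have hne := mem_closure_iff_nhdsWithin_neBot.1 hz
    have hcl : z ∈ closure (interior D) := closure_mono (fun z hz => hz.1) hz
    have hmono : 𝓝[{z | z ∈ interior D ∧ Φ z - ⟪w, z⟫ ≤ M}] z ≤ 𝓝[interior D] z :=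
      nhdsWithin_mono z fun z hz => hz.1
    have hinner : Tendsto (fun z => ⟪w, z⟫) (𝓝[{z | z ∈ interior D ∧ Φ z - ⟪w, z⟫ ≤ M}] z)
        (𝓝 ⟪w, z⟫) :=
      (Continuous.tendsto (by fun_prop) z).mono_left nhdsWithin_le_nhds
    -- A limit point of the sublevel set on the boundary is excluded by the blow-up of `Φ`.
    by_cases hzD : z ∈ interior D
    · refine ⟨hzD, le_of_tendsto ((((hΦ.hasFDerivAt hzD).continuousAt.tendsto).mono_left
        nhdsWithin_le_nhds).sub hinner) ?_⟩
      filter_upwards [self_mem_nhdsWithin] with q hq using hq.2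
    · exfalso
      have hfr : z ∈ frontier (interior D) := by
        rw [isOpen_interior.frontier_eq]
        exact ⟨hcl, hzD⟩
      have h1 := (hΦ.tendsto_frontier z hfr).mono_left hmono
      obtain ⟨q, ⟨h2, h3⟩, h4⟩ := (((h1.eventually_gt_atTop (M + (⟪w, z⟫ + 1))).and
        (hinner.eventually_lt_const (lt_add_one ⟪w, z⟫))).and self_mem_nhdsWithin).exists
      have := h4.2
      linarith
  · obtain ⟨R, hR⟩ := exists_inner_le_of_forall_recCone hD hconv hε hw
    -- With `s = 4 * ϑ / ε` the loss in `Φ` is `ε / 4` per unit length, against a gain of `ε / 2`.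
    set s := 4 * ϑ / ε with hs
    have hs0 : 0 < s := by positivity
    set C := Φ z0 - ‖fderiv ℝ Φ z0‖ * s with hC
    refine isBounded_iff_forall_norm_le.2
      ⟨max (max R (‖z0‖ + s)) ((M - C) * (4 / ε) + ‖z0‖), fun z hz => ?_⟩
    by_contra! hlt
    rw [max_lt_iff, max_lt_iff] at hlt
    obtain ⟨⟨h1, h2⟩, h3⟩ := hlt
    have h4 := hR z (interior_subset hz.1) h1.le
    have h5 : s ≤ ‖z - z0‖ := by
      have := norm_sub_norm_le z z0
      linarith
    have h6 := hΦ.sublinear_lower_bound hϑ hz0 hz.1 hs0 h5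
    have h7 : ϑ / s = ε / 4 := by
      rw [hs]
      field_simp
    rw [h7] at h6
    have h8 : ε / 4 * ‖z - z0‖ ≤ ε / 4 * (‖z‖ + ‖z0‖) :=
      mul_le_mul_of_nonneg_left (norm_sub_le z z0) (by positivity)
    have h9 : (M - C) < ε / 4 * (‖z‖ - ‖z0‖) := by
      have h10 : (M - C) * (4 / ε) < ‖z‖ - ‖z0‖ := by linarith
      have h11 := mul_lt_mul_of_pos_left h10 (show 0 < ε / 4 by positivity)
      have h12 : ε / 4 * ((M - C) * (4 / ε)) = M - C := by field_simp
      linarith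
    have := hz.2
    linarith

variable [CompleteSpace F]

lemma exists_gradient_eq (hΦ : IsSelfConcordantBarrier Φ (interior D) ϑ) (hϑ : 0 < ϑ)
    (hD : IsClosed D) (hconv : Convex ℝ D) {w : F} {ε : ℝ} (hε : 0 < ε)
    (hw : ∀ h ∈ recCone D, ⟪w, h⟫ ≤ -ε * ‖h‖) (hne : (interior D).Nonempty) :
    ∃ p ∈ interior D, gradient Φ p = w := by
  -- A minimizer `p` of `Φ - ⟪w, ·⟫` satisfies `Φ'(p) = w`.
  obtain ⟨z0, hz0⟩ := hne
  have hder : ∀ z ∈ interior D, HasFDerivAt (fun z => Φ z - ⟪w, z⟫)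
      (fderiv ℝ Φ z - innerSL ℝ w) z := fun z hz =>
    (hΦ.hasFDerivAt hz).sub (innerSL ℝ w).hasFDerivAt
  have hcont : ContinuousOn (fun z => Φ z - ⟪w, z⟫)
      {z | z ∈ interior D ∧ Φ z - ⟪w, z⟫ ≤ Φ z0 - ⟪w, z0⟫} := fun z hz =>
    (hder z hz.1).continuousAt.continuousWithinAt
  obtain ⟨p, hp, hmin⟩ := (hΦ.isCompact_sublevel hϑ hD hconv hε hw hz0
    (Φ z0 - ⟪w, z0⟫)).exists_isMinOn ⟨z0, hz0, le_rfl⟩ hcont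
  have hloc : IsLocalMin (fun z => Φ z - ⟪w, z⟫) p := by
    filter_upwards [isOpen_interior.mem_nhds hp.1] with z hz
    by_cases h : Φ z - ⟪w, z⟫ ≤ Φ z0 - ⟪w, z0⟫
    · exact hmin ⟨hz, h⟩
    · exact hp.2.trans (not_le.1 h).le
  have h0 := hloc.hasFDerivAt_eq_zero (hder p hp.1)
  refine ⟨p, hp.1, ext_inner_right ℝ fun v => ?_⟩
  rw [inner_gradient_left]
  exact congrArg (fun L : F →L[ℝ] ℝ => L v) (sub_eq_zero.1 h0)

/-- Near `Φ'(p)`, the gradient of the conjugate is the local inverse of `Φ'`. Hence it maps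
`Φ'(p)` to `p`, and the Hessian of the conjugate at `Φ'(p)` is the inverse of the Hessian of `Φ`
at `p`. -/
lemma conjugateGradient_gradient_and_inverse_conjugateHessian
    (hΦ : IsSelfConcordantBarrier Φ (interior D) ϑ) {p : F} (hp : p ∈ interior D)
    (hpd : ∀ h : F, h ≠ 0 → 0 < iteratedFDeriv ℝ 2 Φ p fun _ => h) :
    conjugateGradient Φ D (gradient Φ p) = p ∧
      ∀ v : F, ⟪v, (conjugateHessian Φ D (gradient Φ p)).inverse v⟫ =
        iteratedFDeriv ℝ 2 Φ p fun _ => v := by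
  -- The Riesz isomorphism is conjugate-linear in general; `J` is its real linear form.
  let J : (F →L[ℝ] ℝ) →L[ℝ] F :=
    { toFun := fun L => (InnerProductSpace.toDual ℝ F).symm L
      map_add' := fun L L' => map_add _ L L'
      map_smul' := fun r L => by simp
      cont := (InnerProductSpace.toDual ℝ F).symm.continuous }
  have hgrad : gradient Φ = fun z => J (fderiv ℝ Φ z) := rfl
  have hC1 : ContDiffAt ℝ 1 (gradient Φ) p := by
    rw [hgrad]
    exact J.contDiff.contDiffAt.comp p ((hΦ.contDiffAt hp).fderiv_right (by norm_num))
  set H : F →L[ℝ] F := J ∘L fderiv ℝ (fderiv ℝ Φ) p with hH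
  have hHd : HasFDerivAt (gradient Φ) H p := J.hasFDerivAt.comp p (hΦ.hasFDerivAt_fderiv hp)
  have hHv : ∀ v, ⟪v, H v⟫ = iteratedFDeriv ℝ 2 Φ p fun _ => v := fun v => by
    rw [iteratedFDeriv_two_apply, real_inner_comm]
    exact InnerProductSpace.toDual_symm_apply
  have hinj : Function.Injective H := by
    refine (injective_iff_map_eq_zero H).2 fun v hv => ?_
    by_contra hne
    have := hpd v hne
    rw [← hHv, hv, inner_zero_right] at this
    exact lt_irrefl _ this
  set e : F ≃L[ℝ] F :=
    (LinearEquiv.ofInjectiveEndo (H : F →ₗ[ℝ] F) hinj).toContinuousLinearEquiv with he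
  have heH : (e : F →L[ℝ] F) = H := by
    ext v
    rfl
  have hed : HasFDerivAt (gradient Φ) (e : F →L[ℝ] F) p := heH ▸ hHd
  have hstrict := hC1.hasStrictFDerivAt' hed one_ne_zero
  set g : F → F := hC1.localInverse hed one_ne_zero with hg
  have hgp : g (gradient Φ p) = p := hC1.localInverse_apply_image hed one_ne_zero
  have hgC1 : ContDiffAt ℝ 1 g (gradient Φ p) := hC1.to_localInverse hed one_ne_zero
  have hright : ∀ᶠ v in 𝓝 (gradient Φ p), gradient Φ (g v) = v := hstrict.eventually_right_inverse
  have hmem : ∀ᶠ v in 𝓝 (gradient Φ p), g v ∈ interior D :=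
    hgC1.continuousAt.eventually_mem (by rw [hgp]; exact isOpen_interior.mem_nhds hp)
  have hdiff : ∀ᶠ v in 𝓝 (gradient Φ p), DifferentiableAt ℝ g v := by
    filter_upwards [hgC1.eventually (by simp)] with v hv using hv.differentiableAt one_ne_zero
  have hconj : ∀ᶠ v in 𝓝 (gradient Φ p), conjugate Φ D v = ⟪v, g v⟫ - Φ (g v) := by
    filter_upwards [hright, hmem] with v h1 h2
    have := hΦ.conjugate_gradient h2
    rwa [h1] at this
  have hgradconj : conjugateGradient Φ D =ᶠ[𝓝 (gradient Φ p)] g := by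
    filter_upwards [hright, hmem, hdiff, hconj.eventually_nhds] with v h1 h2 h3 h4
    have d1 : HasFDerivAt (fun u => ⟪u, g u⟫ - Φ (g u))
        ((fderivInnerCLM ℝ (v, g v)).comp ((ContinuousLinearMap.id ℝ F).prod (fderiv ℝ g v)) -
          (fderiv ℝ Φ (g v)).comp (fderiv ℝ g v)) v :=
      ((hasFDerivAt_id v).inner ℝ h3.hasFDerivAt).sub
        ((hΦ.hasFDerivAt h2).comp v h3.hasFDerivAt)
    have d2 : HasGradientAt (conjugate Φ D) (g v) v := by
      rw [hasGradientAt_iff_hasFDerivAt]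
      refine (d1.congr_of_eventuallyEq h4).congr_fderiv ?_
      -- The contributions of the derivative of `g` cancel, since `Φ'(g v) = v`.
      ext u
      have h5 := inner_gradient_left (f := Φ) (x := g v) (y := fderiv ℝ g v u)
      rw [h1] at h5
      simp [h5, real_inner_comm]
    exact d2.gradient
  refine ⟨hgradconj.eq_of_nhds.trans hgp, fun v => ?_⟩
  have hhess : conjugateHessian Φ D (gradient Φ p) = (e.symm : F →L[ℝ] F) := by
    rw [conjugateHessian, hgradconj.fderiv_eq]
    exact hstrict.to_localInverse.hasFDerivAt.fderiv
  rw [hhess, ContinuousLinearMap.inverse_equiv, ContinuousLinearEquiv.symm_symm, heH, hHv]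

end IsSelfConcordantBarrier

/-! ### The duality gap estimate -/

lemma inner_add_inner_le_of_dualityGap_eq {E F : Type*} [NormedAddCommGroup E] [InnerProductSpace ℝ E]
    [NormedAddCommGroup F] [InnerProductSpace ℝ F] {c x : E} {D : Set F} {y z : F} {Λ : ℝ}
    (hΛ : dualityGap c D x y = (Λ : EReal)) (hz : z ∈ D) : ⟪c, x⟫ + ⟪y, z⟫ ≤ Λ := by
  have h1 : ((⟪y, z⟫ : ℝ) : EReal) ≤ supportFun D y :=
    le_iSup₂ (f := fun z (_ : z ∈ D) => ((⟪y, z⟫ : ℝ) : EReal)) z hz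
  have h2 := add_le_add_right h1 ((⟪c, x⟫ : ℝ) : EReal)
  rw [dualityGap] at hΛ
  rw [hΛ] at h2
  exact_mod_cast h2

/-- A point `u` within local distance `κ` of `Φ_*'(w)` satisfies `⟪w, z⟫ ≤ ⟪w, u⟫ + ϑ + κ √ϑ` for
every `z ∈ D`: with `p = Φ_*'(w)` and `w = Φ'(p)`, the term `⟪w, z - p⟫` is at most `ϑ` by
semiboundedness, and `⟪w, p - u⟫` is at most `√ϑ` times the local norm of `u - p`. -/
lemma IsSelfConcordantBarrier.inner_le_of_invNorm_le {F : Type*} [NormedAddCommGroup F]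
    [InnerProductSpace ℝ F] [FiniteDimensional ℝ F] [CompleteSpace F] {Φ : F → ℝ} {D : Set F}
    {ϑ : ℝ} (hΦ : IsSelfConcordantBarrier Φ (interior D) ϑ) (hϑ : 0 < ϑ) (hD : IsClosed D)
    (hconv : Convex ℝ D) (hne : (interior D).Nonempty) {y : F}
    (hy : y ∈ interior (dualCone D)) {r : ℝ} (hr : 0 < r) {u : F} {κ : ℝ}
    (hκ : invNorm (conjugateHessian Φ D (r • y)) (u - conjugateGradient Φ D (r • y)) ≤ κ)
    {z : F} (hz : z ∈ D) : ⟪r • y, z⟫ ≤ ⟪r • y, u⟫ + ϑ + κ * √ϑ := by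
  obtain ⟨ε, hε, hle⟩ := exists_inner_le_of_mem_interior_dualCone hy
  obtain ⟨p, hp, hpw⟩ := hΦ.exists_gradient_eq hϑ hD hconv (w := r • y) (mul_pos hr hε)
    (fun h hh => by
      have := mul_le_mul_of_nonneg_left (hle h hh) hr.le
      rw [real_inner_smul_left]
      linarith) hne
  rw [← hpw] at hκ ⊢
  obtain ⟨h1, h2⟩ := hΦ.conjugateGradient_gradient_and_inverse_conjugateHessian hp
    (fun h hh => hΦ.hessian_pos hϑ hD hconv hy hp hh)
  rw [h1, invNorm, h2] at hκ
  have hzcl : z ∈ closure (interior D) := by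
    rw [hconv.closure_interior_eq_closure_of_nonempty_interior hne]
    exact subset_closure hz
  have h3 := hΦ.fderiv_sub_le_param_of_mem_closure hϑ hp hzcl
  have h4 := (abs_le.1 (hΦ.abs_fderiv_le hp (u - p))).1
  have h5 := mul_le_mul_of_nonneg_left hκ (Real.sqrt_nonneg ϑ)
  rw [← inner_gradient_left, inner_sub_right] at h3 h4
  linarith

theorem mainTheorem8 {n m : ℕ} (hm : 0 < m)
    (A : EuclideanSpace ℝ (Fin n) →L[ℝ] EuclideanSpace ℝ (Fin m)) (hA : Function.Injective A)
    (c : EuclideanSpace ℝ (Fin n))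
    (D : Set (EuclideanSpace ℝ (Fin m))) (hDclosed : IsClosed D) (hDconvex : Convex ℝ D)
    (Φ : EuclideanSpace ℝ (Fin m) → ℝ) (ϑ : ℝ)
    (hΦ : IsSelfConcordantBarrier Φ (interior D) ϑ)
    (ξ : ℝ) (hξ : 1 < ξ)
    (z0 : EuclideanSpace ℝ (Fin m)) (hz0 : z0 ∈ interior D)
    (xbar : EuclideanSpace ℝ (Fin n)) (hxbar : xbar ∈ primalFeasible A D)
    (ybar : EuclideanSpace ℝ (Fin m)) (hybar : ybar ∈ dualFeasible A c D)
    (Λ : ℝ) (hΛ : dualityGap c D xbar ybar = (Λ : EReal))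
    (κ : ℝ) (x : EuclideanSpace ℝ (Fin n)) (τ : ℝ) (y : EuclideanSpace ℝ (Fin m))
    (hclose : IsCloseToCentralPath A c D Φ ϑ ξ z0 κ x τ y) :
    ((ξ - 1) * ϑ - κ * √ϑ) * (muValue A c Φ ϑ ξ z0 x τ y / τ) ≤
        ξ * ϑ + ⟪initialDual Φ z0 - ybar, z0 - A xbar⟫ + τ * Λ ∧
    (κ < ξ - 1 → Λ = 0 →
      0 < (ξ - 1) * ϑ - κ * √ϑ ∧
      0 < ξ * ϑ + ⟪initialDual Φ z0 - ybar, z0 - A xbar⟫ ∧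
      muValue A c Φ ϑ ξ z0 x τ y ≤
        ((ξ * ϑ + ⟪initialDual Φ z0 - ybar, z0 - A xbar⟫) /
          ((ξ - 1) * ϑ - κ * √ϑ)) * τ) := by
  obtain ⟨⟨huD, hτ, hAy, hy⟩, hμ, hκ⟩ := hclose
  -- For `ϑ = 0` the division by `ξ * ϑ` would make `μ` vanish.
  have hϑ : 0 < ϑ := by
    refine lt_of_le_of_ne hΦ.parameter_nonneg fun h0 => ?_
    rw [muValue, ← h0] at hμ
    simp at hμ
  have hξϑ : 0 < ξ * ϑ := mul_pos (by linarith) hϑ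
  have hne : (interior D).Nonempty := ⟨z0, hz0⟩
  have hμdef : muValue A c Φ ϑ ξ z0 x τ y / τ * (ξ * ϑ) =
      ⟪initialDual Φ z0, z0⟫ + ξ * ϑ - τ * ⟪c, x⟫ - ⟪y, A x + (1 / τ) • z0⟫ := by
    rw [muValue, initialYTau]
    field_simp
    ring
  set μ := muValue A c Φ ϑ ξ z0 x τ y with hμ_eq
  set u := A x + (1 / τ) • z0 with hu
  set y0 := initialDual Φ z0 with hy0
  have hκ0 : 0 ≤ κ := (Real.sqrt_nonneg _).trans hκ
  have hsemi : ⟪y, A xbar⟫ ≤ ⟪y, u⟫ + μ / τ * (ϑ + κ * √ϑ) := by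
    have h1 := hΦ.inner_le_of_invNorm_le hϑ hDclosed hDconvex hne hy (div_pos hτ hμ) hκ hxbar
    rw [real_inner_smul_left, real_inner_smul_left] at h1
    have h2 := mul_le_mul_of_nonneg_left h1 (div_pos hμ hτ).le
    have h3 : ∀ a : ℝ, μ / τ * (τ / μ * a) = a := fun a => by field_simp
    rw [add_assoc, mul_add, h3, h3] at h2
    exact h2
  have hyA : ⟪y, A xbar⟫ = ⟪y0, A xbar⟫ - (τ - 1) * ⟪c, xbar⟫ := by
    have h1 := congrArg (fun v => ⟪v, xbar⟫) hAy
    simp only [inner_sub_left, ContinuousLinearMap.adjoint_inner_left, inner_neg_left,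
      real_inner_smul_left] at h1
    linarith
  have hybarA : ∀ v, ⟪ybar, A v⟫ = -⟪c, v⟫ := fun v => by
    rw [← ContinuousLinearMap.adjoint_inner_left, hybar.2, inner_neg_left]
  have hgap : τ * ⟪c, xbar⟫ - τ * ⟪c, x⟫ + ⟪ybar, z0⟫ ≤ τ * Λ := by
    have h1 := inner_add_inner_le_of_dualityGap_eq hΛ (interior_subset huD)
    rw [hu, inner_add_right, hybarA, real_inner_smul_right] at h1
    have h2 := mul_le_mul_of_nonneg_left h1 hτ.le
    have h3 : τ * (1 / τ * ⟪ybar, z0⟫) = ⟪ybar, z0⟫ := by field_simp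
    linarith
  have hexp : ⟪y0 - ybar, z0 - A xbar⟫ =
      ⟪y0, z0⟫ - ⟪y0, A xbar⟫ - ⟪ybar, z0⟫ - ⟪c, xbar⟫ := by
    rw [inner_sub_left, inner_sub_right, inner_sub_right, hybarA]
    ring
  have hmain : ((ξ - 1) * ϑ - κ * √ϑ) * (μ / τ) ≤
      ξ * ϑ + ⟪y0 - ybar, z0 - A xbar⟫ + τ * Λ := by
    rw [hexp]
    linarith
  refine ⟨hmain, fun hκξ hΛ0 => ?_⟩
  have hϑ1 : 1 ≤ ϑ := by
    have : Nonempty (Fin m) := ⟨⟨0, hm⟩⟩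
    refine hΦ.one_le_param hϑ hz0 (fun huniv => ?_)
      (fun z hz h hh => hΦ.hessian_pos hϑ hDclosed hDconvex hy hz hh)
    -- If `D` is the whole space, both `h` and `-h` are recession directions.
    have hDu : ∀ q, q ∈ D := fun q => interior_subset (huniv ▸ mem_univ q)
    obtain ⟨h, hh⟩ := exists_ne (0 : EuclideanSpace ℝ (Fin m))
    obtain ⟨ε, hε, hle⟩ := exists_inner_le_of_mem_interior_dualCone hy
    have e1 := hle h fun _ _ _ _ => hDu _
    have e2 := hle (-h) fun _ _ _ _ => hDu _
    rw [norm_neg, inner_neg_right] at e2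
    have := mul_pos hε (norm_pos_iff.2 hh)
    linarith
  have hsqrt : √ϑ ≤ ϑ := (Real.sqrt_le_left hϑ.le).2 (by nlinarith)
  have hpos : 0 < (ξ - 1) * ϑ - κ * √ϑ := by
    have h1 := mul_le_mul_of_nonneg_left hsqrt hκ0
    have h2 := mul_lt_mul_of_pos_right hκξ hϑ
    linarith
  rw [hΛ0, mul_zero, add_zero] at hmain
  refine ⟨hpos, (mul_pos hpos (div_pos hμ hτ)).trans_le hmain, ?_⟩
  rw [← div_le_iff₀ hτ, le_div_iff₀ hpos, mul_comm]
  exact hmain
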